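/- **Setting.** Let $T>0$, let $\mathcal T\subseteq[0,T]$ with $T\in\mathcal T$, and let $(\Omega,(\mathcal F_t)_{t\in\mathcal T},P)$ be a filtered probability space. (In)equalities between random variables hold almost surely. $L^{bb}_t$ is the set of $(-\infty,+\infty]$-valued $\mathcal F_t$-measurable random variables that are essentially bounded from below, and $L^\infty_t=L^\infty(\Omega,\mathcal F_t,P)$. A *performance measure conditional to $\mathcal F_t$* (CPM) is a map $\beta_t:L^{bb}_T\to L^{bb}_t$ such that 1. $\beta_t(cX+(1-c)Y)\ge\min(\beta_t(X),\beta_t(Y))$ for all real $c\in[0,1]$; 2. $z_d=\operatorname{ess\,inf}_X\beta_t(X)$ and $z_u=\operatorname{ess\,sup}_X\beta_t(X)$ are non-random (possibly infinite) and $z_d<z_u$; 3. (a) $\beta_t(X)\ge\beta_t(Y)$ if $X\ge Y$; (b) for every real $c>0$, $\beta_t(X+c)>\beta_t(X)$ on $\{\beta_t(X)<z_u\}\cap\{\beta_t(X+c)>z_d\}$; 4. $\beta_t(X_n)\to\beta_t(X)$ if $X_n\uparrow X\in L^{bb}_T$; 5. $I_B\beta_t(X)=I_B\beta_t(XI_B)$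 for all $B\in\mathcal F_t$; 6. for every real $z\in(z_d,z_u)$, with $A^z_t=\{X\in L^{bb}_T:\beta_t(X)\ge z\}$, there is $x_z\in\mathbb R$ with $\xi\ge x_z$ for all $\xi\in A^z_t\cap L^{bb}_t$. A *dynamic performance measure* (DPM) is a family $\beta=(\beta_t)_{t\in\mathcal T}$ of CPMs whose $z_d,z_u$ do not depend on $t$. It is *time consistent* if for all real $z\in(z_d,z_u)$, all $X\in L^{bb}_T$ and all $s<t$ in $\mathcal T$: $\beta_t(X)>z$ a.s. implies $\beta_s(X)>z$ a.s. For real $z\in(z_d,z_u)$ the induced risk measures are $$\rho^z_t(X)=\operatorname{ess\,inf}\{\xi\in L^{bb}_t:\ \beta_t(X+\xi)\ge z\},$$ and for a probability measure $Q\ll P$ the minimal penalties are $$\alpha^z_t(Q)=\operatorname*{ess\,sup}_{Z\in L^\infty_T}\big(E^Q[-Z\mid\mathcal F_t]-\rho^z_t(Z)\big),$$ the essential supremum being taken with respect to $Q$. **Statement.** Let $\beta$ be a time consistent DPM, let $z\in(z_d,z_u)$ be real, and let $s<t$ be in $\mathcal T$. Suppose that the level set $A^z_t$ contains a real constant, i.e.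 $\beta_t(x)\ge z$ a.s. for some $x\in\mathbb R$. Then for every probability measure $Q\ll P$ the random variable $\alpha^z_t(Q)$ is $Q$-essentially bounded from below, so that $E^Q[\alpha^z_t(Q)\mid\mathcal F_s]$ is well defined in $(-\infty,+\infty]$, and $$E^Q[\alpha^z_t(Q)\mid\mathcal F_s]\le\alpha^z_s(Q)\qquad Q\text{-a.s.}$$ -/

import Mathlib

open MeasureTheory Filter Topology Set

namespace PerfMeas

/-! ## Extended-valued random variables -/

section Basic

variable {Ω : Type*}

/-- `X` is (a version of) an `m`-measurable random variable with values in `(-∞, +∞]` which is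
`P`-essentially bounded from below: the lattice `L^{bb}(Ω, m, P)`. Values are taken in `EReal`, the
value `-∞` being possible on a `P`-null set only. -/
def MemLbb (m : MeasurableSpace Ω) {m0 : MeasurableSpace Ω} (P : Measure Ω) (X : Ω → EReal) : Prop :=
  Measurable[m] X ∧ ∃ c : ℝ, ∀ᵐ ω ∂P, (c : EReal) ≤ X ω

/-- `Z` is (a version of) an `m`-measurable real random variable which is `P`-essentially bounded:
the space `L^∞(Ω, m, P)`. -/
def MemLinf (m : MeasurableSpace Ω) {m0 : MeasurableSpace Ω} (P : Measure Ω) (Z : Ω → ℝ) : Prop :=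
  Measurable[m] Z ∧ ∃ c : ℝ, ∀ᵐ ω ∂P, |Z ω| ≤ c

/-- `ξ` is the essential supremum, on `(Ω, m, μ)`, of the family `S`: the least `m`-measurable
random variable which dominates every member of `S` almost surely. -/
def IsEssSup (m : MeasurableSpace Ω) {m0 : MeasurableSpace Ω} (μ : Measure Ω)
    (S : Set (Ω → EReal)) (ξ : Ω → EReal) : Prop :=
  Measurable[m] ξ ∧ (∀ η ∈ S, ∀ᵐ ω ∂μ, η ω ≤ ξ ω) ∧
    ∀ ζ : Ω → EReal, Measurable[m] ζ → (∀ η ∈ S, ∀ᵐ ω ∂μ, η ω ≤ ζ ω) → ∀ᵐ ω ∂μ, ξ ω ≤ ζ ω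

/-- `ξ` is the essential infimum, on `(Ω, m, μ)`, of the family `S`: the greatest `m`-measurable
random variable which is dominated by every member of `S` almost surely. -/
def IsEssInf (m : MeasurableSpace Ω) {m0 : MeasurableSpace Ω} (μ : Measure Ω)
    (S : Set (Ω → EReal)) (ξ : Ω → EReal) : Prop :=
  Measurable[m] ξ ∧ (∀ η ∈ S, ∀ᵐ ω ∂μ, ξ ω ≤ η ω) ∧
    ∀ ζ : Ω → EReal, Measurable[m] ζ → (∀ η ∈ S, ∀ᵐ ω ∂μ, ζ ω ≤ η ω) → ∀ᵐ ω ∂μ, ζ ω ≤ ξ ω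

/-- Every family of `m`-measurable random variables has an essential supremum. -/
theorem exists_isEssSup (m : MeasurableSpace Ω) {m0 : MeasurableSpace Ω} (hm : m ≤ m0)
    (μ : Measure Ω) [IsFiniteMeasure μ] (S : Set (Ω → EReal)) (hS : ∀ η ∈ S, Measurable[m] η) :
    ∃ ξ, IsEssSup m μ S ξ := by
  classical
  let φ : EReal → ENNReal := fun x => ENNReal.orderIsoIicOneBirational (EReal.expOrderIso x)
  have hφ : StrictMono φ := fun x y hxy =>
    ENNReal.orderIsoIicOneBirational.strictMono (EReal.expOrderIso.strictMono hxy)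
  have hφ1 : ∀ x, φ x ≤ 1 := fun x => (ENNReal.orderIsoIicOneBirational (EReal.expOrderIso x)).2
  have hφm : Measurable φ := hφ.monotone.measurable
  have hcount : ∀ c : Set (Ω → EReal), c.Countable → c ⊆ S →
      Measurable[m] (fun ω => ⨆ η ∈ c, η ω) := by
    intro c hc hcS
    exact Measurable.biSup c hc (fun η hη => hS η (hcS hη))
  let I : Set (Ω → EReal) → ENNReal := fun c => ∫⁻ ω, φ (⨆ η ∈ c, η ω) ∂μ
  let K : Set (Set (Ω → EReal)) := {c | c.Countable ∧ c ⊆ S}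
  have hK : K.Nonempty := ⟨∅, countable_empty, empty_subset S⟩
  have hmono : ∀ c d : Set (Ω → EReal), c ⊆ d → I c ≤ I d := by
    intro c d hcd
    exact lintegral_mono fun ω => hφ.monotone (biSup_mono fun η hη => hcd hη)
  obtain ⟨u, -, hulim, huK⟩ := exists_seq_tendsto_sSup (hK.image I) (OrderTop.bddAbove _)
  choose c hcK hcu using huK
  let C : Set (Ω → EReal) := ⋃ n, c n
  have hCc : C.Countable := countable_iUnion fun n => (hcK n).1
  have hCS : C ⊆ S := iUnion_subset fun n => (hcK n).2
  have hmax : ∀ d ∈ K, I d ≤ I C := by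
    intro d hd
    refine (le_sSup (mem_image_of_mem I hd)).trans (le_of_tendsto' hulim fun n => ?_)
    rw [← hcu n]
    exact hmono _ _ (subset_iUnion c n)
  refine ⟨fun ω => ⨆ η ∈ C, η ω, hcount C hCc hCS, ?_, ?_⟩
  · intro η hη
    have hd : insert η C ∈ K := ⟨hCc.insert η, insert_subset hη hCS⟩
    have hfin : ∫⁻ ω, φ (⨆ η ∈ C, η ω) ∂μ ≠ ⊤ := by
      refine ne_top_of_le_ne_top (measure_ne_top μ univ) ?_
      calc ∫⁻ ω, φ (⨆ η ∈ C, η ω) ∂μ ≤ ∫⁻ _, 1 ∂μ := lintegral_mono fun ω => hφ1 _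
        _ = μ univ := lintegral_one
    have hae := ae_eq_of_ae_le_of_lintegral_le (μ := μ)
      (f := fun ω => φ (⨆ η ∈ C, η ω)) (g := fun ω => φ (⨆ θ ∈ insert η C, θ ω))
      (Eventually.of_forall fun ω => hφ.monotone (biSup_mono fun θ hθ => mem_insert_of_mem _ hθ))
      hfin
      (hφm.comp ((hcount _ hd.1 hd.2).mono hm le_rfl)).aemeasurable (hmax _ hd)
    filter_upwards [hae] with ω hω
    rw [hφ.injective hω]
    exact le_biSup (fun θ : Ω → EReal => θ ω) (mem_insert η C)
  · intro ζ _ hζ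
    have : ∀ᵐ ω ∂μ, ∀ η ∈ C, η ω ≤ ζ ω := (ae_ball_iff hCc).2 fun η hη => hζ η (hCS hη)
    filter_upwards [this] with ω hω
    exact iSup₂_le hω

/-- Every family of `m`-measurable random variables has an essential infimum. -/
theorem exists_isEssInf (m : MeasurableSpace Ω) {m0 : MeasurableSpace Ω} (hm : m ≤ m0)
    (μ : Measure Ω) [IsFiniteMeasure μ] (S : Set (Ω → EReal)) (hS : ∀ η ∈ S, Measurable[m] η) :
    ∃ ξ, IsEssInf m μ S ξ := by
  have hneg : ∀ f : Ω → EReal, Measurable[m] f → Measurable[m] (fun ω => - f ω) :=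
    fun f hf => measurable_neg.comp hf
  obtain ⟨ξ, hξ, hub, hlub⟩ := exists_isEssSup m hm μ ((fun η ω => - η ω) '' S)
    (by rintro _ ⟨η, hη, rfl⟩; exact hneg η (hS η hη))
  refine ⟨fun ω => - ξ ω, hneg ξ hξ, ?_, ?_⟩
  · intro η hη
    filter_upwards [hub _ (mem_image_of_mem _ hη)] with ω hω
    exact EReal.neg_le.1 hω
  · intro ζ hζ h
    have := hlub (fun ω => - ζ ω) (hneg ζ hζ) (by
      rintro _ ⟨η, hη, rfl⟩
      filter_upwards [h η hη] with ω hω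
      exact EReal.neg_le_neg_iff.2 hω)
    filter_upwards [this] with ω hω
    exact EReal.le_neg_of_le_neg hω

open Classical in
/-- A version of the essential supremum of the family `S` on `(Ω, m, μ)`; it exists whenever the
members of `S` are `m`-measurable, see `exists_isEssSup`. -/
noncomputable def essSupFam (m : MeasurableSpace Ω) {m0 : MeasurableSpace Ω} (μ : Measure Ω)
    (S : Set (Ω → EReal)) : Ω → EReal :=
  if h : ∃ ξ, IsEssSup m μ S ξ then h.choose else fun _ => 0

open Classical in
/-- A version of the essential infimum of the family `S` on `(Ω, m, μ)`; it exists whenever the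
members of `S` are `m`-measurable, see `exists_isEssInf`. -/
noncomputable def essInfFam (m : MeasurableSpace Ω) {m0 : MeasurableSpace Ω} (μ : Measure Ω)
    (S : Set (Ω → EReal)) : Ω → EReal :=
  if h : ∃ ξ, IsEssInf m μ S ξ then h.choose else fun _ => 0

/-- The conditional expectation `E^Q[Y | m] = E^Q[Y⁺ | m] - E^Q[Y⁻ | m]` of an extended-valued random
variable; meaningful as soon as one of the two terms is finite, for instance if `Y` is bounded from
below. -/
noncomputable def condExpExt (m : MeasurableSpace Ω) {m0 : MeasurableSpace Ω} (Q : Measure Ω)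
    (Y : Ω → EReal) : Ω → EReal := fun ω =>
  (condLExp m Q (fun ω' => (Y ω').toENNReal) ω : EReal)
    - (condLExp m Q (fun ω' => (- Y ω').toENNReal) ω : EReal)

end Basic

/-! ## Performance measures -/

section Performance

variable {Ω : Type*}

/-- `β` is a performance measure conditional to `mt` (a CPM), on the lattice `L^{bb}` of the
σ-algebra `mT`, with infimum `zd` and supremum `zu`. Only the values of `β` on `L^{bb}` matter. By
monotonicity, `β` is well defined on almost sure equivalence classes. -/
structure IsCPM {m0 : MeasurableSpace Ω} (P : Measure Ω) (mT mt : MeasurableSpace Ω)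
    (zd zu : EReal) (β : (Ω → EReal) → (Ω → EReal)) : Prop where
  mem : ∀ X, MemLbb mT P X → MemLbb mt P (β X)
  quasiconcave : ∀ c : ℝ, 0 ≤ c → c ≤ 1 → ∀ X Y, MemLbb mT P X → MemLbb mT P Y →
    ∀ᵐ ω ∂P, min (β X ω) (β Y ω) ≤ β (fun ω' => (c : EReal) * X ω' + ((1 - c : ℝ) : EReal) * Y ω') ω
  inf_eq : IsEssInf mt P (β '' {X | MemLbb mT P X}) (fun _ => zd)
  sup_eq : IsEssSup mt P (β '' {X | MemLbb mT P X}) (fun _ => zu)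
  inf_lt_sup : zd < zu
  mono : ∀ X Y, MemLbb mT P X → MemLbb mT P Y → (∀ᵐ ω ∂P, Y ω ≤ X ω) → ∀ᵐ ω ∂P, β Y ω ≤ β X ω
  strict_mono_shift : ∀ X, MemLbb mT P X → ∀ c : ℝ, 0 < c →
    ∀ᵐ ω ∂P, β X ω < zu → zd < β (fun ω' => X ω' + (c : EReal)) ω →
      β X ω < β (fun ω' => X ω' + (c : EReal)) ω
  cont_below : ∀ (X : ℕ → Ω → EReal) (Y : Ω → EReal), (∀ n, MemLbb mT P (X n)) → MemLbb mT P Y →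
    (∀ᵐ ω ∂P, Monotone (fun n => X n ω)) →
    (∀ᵐ ω ∂P, Tendsto (fun n => X n ω) atTop (𝓝 (Y ω))) →
    ∀ᵐ ω ∂P, Tendsto (fun n => β (X n) ω) atTop (𝓝 (β Y ω))
  locality : ∀ X, MemLbb mT P X → ∀ B : Set Ω, MeasurableSet[mt] B →
    ∀ᵐ ω ∂P, B.indicator (β X) ω = B.indicator (β (B.indicator X)) ω
  level_bdd : ∀ z : ℝ, zd < (z : EReal) → (z : EReal) < zu →
    ∃ x : ℝ, ∀ ξ, MemLbb mt P ξ → (∀ᵐ ω ∂P, (z : EReal) ≤ β ξ ω) → ∀ᵐ ω ∂P, (x : EReal) ≤ ξ ω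

/-- A dynamic performance measure (DPM) on the filtration `𝓕`, with final date `T`: a family of CPMs
whose infimum `zd` and supremum `zu` do not depend on the date. -/
def IsDPM {𝒯 : Type*} [Preorder 𝒯] {m0 : MeasurableSpace Ω} (P : Measure Ω)
    (𝓕 : Filtration 𝒯 m0) (T : 𝒯) (zd zu : EReal) (β : 𝒯 → (Ω → EReal) → (Ω → EReal)) : Prop :=
  ∀ t, IsCPM P (𝓕 T) (𝓕 t) zd zu (β t)

/-- Time consistency: `β_t(X) > z` implies `β_s(X) > z`, for all levels `zd < z < zu` and `s < t`. -/
def IsTimeConsistent {𝒯 : Type*} [Preorder 𝒯] {m0 : MeasurableSpace Ω} (P : Measure Ω)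
    (𝓕 : Filtration 𝒯 m0) (T : 𝒯) (zd zu : EReal) (β : 𝒯 → (Ω → EReal) → (Ω → EReal)) : Prop :=
  ∀ z : ℝ, zd < (z : EReal) → (z : EReal) < zu → ∀ X, MemLbb (𝓕 T) P X → ∀ s t : 𝒯, s < t →
    (∀ᵐ ω ∂P, (z : EReal) < β t X ω) → ∀ᵐ ω ∂P, (z : EReal) < β s X ω

/-- The risk measure induced at level `z` by a performance measure `β` conditional to `mt`:
`ρ^z(X) = ess inf {ξ ∈ L^{bb}(mt) | β(X + ξ) ≥ z}`. -/
noncomputable def inducedRisk {m0 : MeasurableSpace Ω} (P : Measure Ω) (mt : MeasurableSpace Ω)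
    (β : (Ω → EReal) → (Ω → EReal)) (z : ℝ) (X : Ω → EReal) : Ω → EReal :=
  essInfFam mt P {ξ | MemLbb mt P ξ ∧ ∀ᵐ ω ∂P, (z : EReal) ≤ β (fun ω' => X ω' + ξ ω') ω}

/-- The minimal penalty of the induced risk measure at level `z`:
`α^z(Q) = ess sup {E^Q[-Z | mt] - ρ^z(Z) | Z ∈ L^∞(mT)}`, the essential supremum being taken with
respect to `Q`, as conditional expectations under `Q` are only defined `Q`-almost surely. -/
noncomputable def minPenalty {m0 : MeasurableSpace Ω} (P Q : Measure Ω) (mT mt : MeasurableSpace Ω)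
    (β : (Ω → EReal) → (Ω → EReal)) (z : ℝ) : Ω → EReal :=
  essSupFam mt Q {η | ∃ Z : Ω → ℝ, MemLinf mT P Z ∧
    η = fun ω => ((condExp mt Q (fun ω' => - Z ω') ω : ℝ) : EReal)
      - inducedRisk P mt β z (fun ω' => (Z ω' : EReal)) ω}

end Performance

end PerfMeas

namespace PerfMeas

/-! ### Essential suprema and infima. -/

section EssentialBounds

variable {Ω : Type*}

/-! The penalty at `t` is the essential supremum of `E^Q[-Y | F_t]` over bounded `Y` with `β_t(Y) >
z` (`condExp_neg_le_minPenalty`, `IsCPM.minPenalty_le`). Indeed, adding to a bounded `Z` its risk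
plus any `ε > 0` makes it strictly acceptable (`IsCPM.add_risk_mem`). The constant in the level set
keeps that risk bounded, so the sum stays in `L^∞`. Strict acceptability is the right notion because
time consistency is stated with `>`.

By locality, acceptable positions can be pasted along events of `F_t`, so these conditional losses
are directed upward. Hence the penalty at `t` is dominated by the limit of an increasing sequence,
each term of which lies below some `E^Q[-W | F_t]` with `W` strictly acceptable at `t`
(`IsCPM.exists_partialSups_le`). By time consistency `W` is strictly acceptable at `s`, and the
tower property gives `E^Q[E^Q[-W | F_t] | F_s] = E^Q[-W | F_s] ≤ α_s`. Conditional monotone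
convergence (`condExpExt_le_of_le_iSup`) passes to the limit. -/

theorem isEssSup_essSupFam {m m0 : MeasurableSpace Ω} (hm : m ≤ m0) (μ : Measure Ω)
    [IsFiniteMeasure μ] {S : Set (Ω → EReal)} (hS : ∀ η ∈ S, Measurable[m] η) :
    IsEssSup m μ S (essSupFam m μ S) := by
  have h := exists_isEssSup m hm μ S hS
  rw [essSupFam, dif_pos h]
  exact h.choose_spec

theorem isEssInf_essInfFam {m m0 : MeasurableSpace Ω} (hm : m ≤ m0) (μ : Measure Ω)
    [IsFiniteMeasure μ] {S : Set (Ω → EReal)} (hS : ∀ η ∈ S, Measurable[m] η) :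
    IsEssInf m μ S (essInfFam m μ S) := by
  have h := exists_isEssInf m hm μ S hS
  rw [essInfFam, dif_pos h]
  exact h.choose_spec

/-- An essential supremum is attained by the pointwise supremum of a countable subfamily. -/
theorem exists_countable_dominating {m0 : MeasurableSpace Ω} (μ : Measure Ω) [IsFiniteMeasure μ]
    (S : Set (Ω → EReal)) (hS : ∀ η ∈ S, Measurable η) :
    ∃ C ⊆ S, C.Countable ∧ ∀ η ∈ S, ∀ᵐ ω ∂μ, η ω ≤ ⨆ θ ∈ C, θ ω := by
  -- Squeezing values into `[0, 1]` keeps the integrals finite. `C` maximises the integral over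
  -- countable subfamilies, so enlarging it by `η` cannot change the supremum almost everywhere.
  let φ : EReal → ENNReal := fun x => ENNReal.orderIsoIicOneBirational (EReal.expOrderIso x)
  have hφ : StrictMono φ := fun x y hxy =>
    ENNReal.orderIsoIicOneBirational.strictMono (EReal.expOrderIso.strictMono hxy)
  have hφ1 : ∀ x, φ x ≤ 1 := fun x => (ENNReal.orderIsoIicOneBirational (EReal.expOrderIso x)).2
  let I : Set (Ω → EReal) → ENNReal := fun c => ∫⁻ ω, φ (⨆ η ∈ c, η ω) ∂μ
  let K : Set (Set (Ω → EReal)) := {c | c.Countable ∧ c ⊆ S}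
  have hK : K.Nonempty := ⟨∅, countable_empty, empty_subset S⟩
  have hmono : ∀ c d : Set (Ω → EReal), c ⊆ d → I c ≤ I d := fun c d hcd =>
    lintegral_mono fun ω => hφ.monotone (biSup_mono fun η hη => hcd hη)
  obtain ⟨u, -, hulim, huK⟩ := exists_seq_tendsto_sSup (hK.image I) (OrderTop.bddAbove _)
  choose c hcK hcu using huK
  let C : Set (Ω → EReal) := ⋃ n, c n
  have hCc : C.Countable := countable_iUnion fun n => (hcK n).1
  have hCS : C ⊆ S := iUnion_subset fun n => (hcK n).2
  have hmax : ∀ d ∈ K, I d ≤ I C := by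
    intro d hd
    refine (le_sSup (mem_image_of_mem I hd)).trans (le_of_tendsto' hulim fun n => ?_)
    rw [← hcu n]
    exact hmono _ _ (subset_iUnion c n)
  refine ⟨C, hCS, hCc, fun η hη => ?_⟩
  have hd : insert η C ∈ K := ⟨hCc.insert η, insert_subset hη hCS⟩
  have hfin : ∫⁻ ω, φ (⨆ η ∈ C, η ω) ∂μ ≠ ⊤ := by
    refine ne_top_of_le_ne_top (measure_ne_top μ univ) ?_
    calc ∫⁻ ω, φ (⨆ η ∈ C, η ω) ∂μ ≤ ∫⁻ _, 1 ∂μ := lintegral_mono fun ω => hφ1 _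
      _ = μ univ := lintegral_one
  have hae := ae_eq_of_ae_le_of_lintegral_le (μ := μ)
    (f := fun ω => φ (⨆ η ∈ C, η ω)) (g := fun ω => φ (⨆ θ ∈ insert η C, θ ω))
    (Eventually.of_forall fun ω => hφ.monotone (biSup_mono fun θ hθ => mem_insert_of_mem _ hθ))
    hfin
    (hφ.monotone.measurable.comp
      (Measurable.biSup _ hd.1 fun η hη => hS η (hd.2 hη))).aemeasurable (hmax _ hd)
  filter_upwards [hae] with ω hω
  rw [hφ.injective hω]
  exact le_biSup (fun θ : Ω → EReal => θ ω) (mem_insert η C)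

end EssentialBounds

/-! ### Conditional expectations of extended-valued variables. -/

section ConditionalExpectation

variable {Ω : Type*}

/-- Conditional monotone convergence. -/
theorem condLExp_iSup {m m0 : MeasurableSpace Ω} (hm : m ≤ m0) (Q : Measure Ω)
    [IsFiniteMeasure Q] {X : ℕ → Ω → ENNReal} (hX : ∀ n, Measurable (X n)) (hmono : Monotone X) :
    (fun ω => ⨆ n, condLExp m Q (X n) ω) =ᵐ[Q] condLExp m Q (fun ω => ⨆ n, X n ω) := by
  refine ae_eq_condLExp hm _ _ (Measurable.iSup fun n => measurable_condLExp m Q (X n)) ?_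
  intro A hA
  rw [lintegral_iSup hX hmono, lintegral_iSup_ae (fun n => measurable_condLExp' m Q (X n))
    fun n => ae_restrict_of_ae (condLExp_mono (Eventually.of_forall (hmono n.le_succ)))]
  simp_rw [setLIntegral_condLExp hm Q _ hA]

/-- Pointwise end of the limit argument: `a`, `b` and `e n` stand for the conditional expectations
of `α⁺`, `α⁻` and `M n`. Subtraction is postponed until `b` is known to be finite. -/
theorem coe_sub_coe_le_of_add_le {a b : ENNReal} {A : EReal} {e : ℕ → ℝ} {c : ℝ}
    (hc : 0 ≤ c) (hb : b ≠ ⊤) (he0 : -c ≤ e 0) (heA : ∀ n, (e n : EReal) ≤ A)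
    (h : a + ENNReal.ofReal c ≤ (⨆ n, ENNReal.ofReal (e n + c)) + b) :
    (a : EReal) - (b : EReal) ≤ A := by
  induction A with
  | bot => simpa using heA 0
  | top => exact le_top
  | coe x =>
    have hx : ∀ n, e n ≤ x := fun n => EReal.coe_le_coe_iff.1 (heA n)
    have h1 : a + ENNReal.ofReal c ≤ ENNReal.ofReal (x + c) + b :=
      h.trans (add_le_add_left (iSup_le fun n => ENNReal.ofReal_le_ofReal (by linarith [hx n])) _)
    lift b to NNReal using hb
    have ha : a ≠ ⊤ := ne_top_of_le_ne_top (by simp) (le_self_add.trans h1)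
    lift a to NNReal using ha
    have h2 := ENNReal.toReal_mono (by simp) h1
    rw [ENNReal.toReal_add (by simp) (by simp), ENNReal.toReal_add (by simp) (by simp),
      ENNReal.toReal_ofReal hc, ENNReal.toReal_ofReal (by linarith [hx 0])] at h2
    simp only [ENNReal.coe_toReal] at h2
    have : ((a : ℝ) : EReal) - ((b : ℝ) : EReal) ≤ (x : EReal) := by
      rw [← EReal.coe_sub, EReal.coe_le_coe_iff]; linarith
    exact this

theorem toENNReal_add_ofReal {x : EReal} {c : ℝ} (hc : 0 ≤ c) (hx : ((-c : ℝ) : EReal) ≤ x) :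
    x.toENNReal + ENNReal.ofReal c = (x + (c : EReal)).toENNReal + (-x).toENNReal := by
  induction x with
  | bot => simp at hx
  | top => simp
  | coe y =>
    have hy : -c ≤ y := EReal.coe_le_coe_iff.1 hx
    rw [← EReal.coe_add, ← EReal.coe_neg]
    simp only [EReal.real_coe_toENNReal]
    rcases le_total 0 y with h | h
    · rw [ENNReal.ofReal_of_nonpos (by linarith : -y ≤ 0), ENNReal.ofReal_add h hc, add_zero]
    · rw [ENNReal.ofReal_of_nonpos h, ← ENNReal.ofReal_add (by linarith) (by linarith), zero_add]
      congr 1; ring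

/-- If `α` is dominated by the limit of a nondecreasing sequence of integrable variables whose
conditional expectations are dominated by `A`, then so is the conditional expectation of `α`. -/
theorem condExpExt_le_of_le_iSup {m m0 : MeasurableSpace Ω} (hm : m ≤ m0) (Q : Measure Ω)
    [IsProbabilityMeasure Q] {α A : Ω → EReal} (hα : Measurable α) {M : ℕ → Ω → ℝ}
    (hM : ∀ n, Measurable (M n)) (hMi : ∀ n, Integrable (M n) Q) (hmono : Monotone M) {c : ℝ}
    (hc : 0 ≤ c) (hαc : ∀ᵐ ω ∂Q, ((-c : ℝ) : EReal) ≤ α ω) (hMc : ∀ᵐ ω ∂Q, -c ≤ M 0 ω)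
    (hαM : ∀ᵐ ω ∂Q, α ω ≤ ⨆ n, (M n ω : EReal))
    (hA : ∀ n, ∀ᵐ ω ∂Q, ((condExp m Q (M n) ω : ℝ) : EReal) ≤ A ω) :
    ∀ᵐ ω ∂Q, condExpExt m Q α ω ≤ A ω := by
  set a : Ω → ENNReal := fun ω => (α ω).toENNReal with ha
  set b : Ω → ENNReal := fun ω => (- α ω).toENNReal with hb
  have ham : Measurable a := hα.ereal_toENNReal
  have hbm : Measurable b := (measurable_neg.comp hα).ereal_toENNReal
  set N : ℕ → Ω → ENNReal := fun n ω => ENNReal.ofReal (M n ω + c) with hN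
  have hNm : ∀ n, Measurable (N n) := fun n => ((hM n).add_const c).ennreal_ofReal
  have hNmono : Monotone N := fun i j hij ω =>
    ENNReal.ofReal_le_ofReal (by linarith [hmono hij ω])
  -- The bound `α ≤ sup M n`, shifted by `c` and written as `α⁺ + c ≤ sup (M n + c) + α⁻`: all terms
  -- are nonnegative, so it survives conditioning in `ENNReal`.
  have hle : a + (fun _ => ENNReal.ofReal c) ≤ᵐ[Q] (fun ω => ⨆ n, N n ω) + b := by
    filter_upwards [hαc, hαM] with ω h1 h2
    simp only [Pi.add_apply, ha, hb]
    rw [toENNReal_add_ofReal hc h1]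
    gcongr
    have h3 : α ω + (c : EReal) ≤ ((⨆ n, N n ω : ENNReal) : EReal) := by
      rw [← EReal.le_sub_iff_add_le (by simp) (by simp)]
      refine h2.trans (iSup_le fun n => ?_)
      rw [EReal.le_sub_iff_add_le (by simp) (by simp), ← EReal.coe_add]
      calc ((M n ω + c : ℝ) : EReal) ≤ ((N n ω : ENNReal) : EReal) := by
            rw [hN, EReal.coe_ennreal_ofReal]
            exact EReal.coe_le_coe_iff.2 (le_max_left _ _)
        _ ≤ _ := EReal.coe_ennreal_le_coe_ennreal_iff.2 (le_iSup (fun n => N n ω) n)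
    simpa using EReal.toENNReal_le_toENNReal h3
  have hbc : b ≤ᵐ[Q] fun _ => ENNReal.ofReal c := by
    filter_upwards [hαc] with ω h1
    have h2 : -α ω ≤ (c : EReal) := by
      rw [EReal.neg_le]; simpa using h1
    simpa [hb] using EReal.toENNReal_le_toENNReal h2
  have hbt : ∀ᵐ ω ∂Q, condLExp m Q b ω ≠ ⊤ := by
    refine condLExp_ne_top (ne_top_of_le_ne_top ?_ (lintegral_mono_ae hbc))
    simp
  have hMn : ∀ n, ∀ᵐ ω ∂Q, condLExp m Q (N n) ω = ENNReal.ofReal (condExp m Q (M n) ω + c) := by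
    intro n
    have h0 : 0 ≤ᵐ[Q] (M n + fun _ => c) := by
      filter_upwards [hMc] with ω h1
      have := hmono (Nat.zero_le n) ω
      simp only [Pi.zero_apply, Pi.add_apply]; linarith
    have h1 := condLExp_ofReal m ((hMi n).add (integrable_const c)) h0
    have h2 := condExp_add (hMi n) (integrable_const (μ := Q) c) m
    filter_upwards [h1, h2] with ω h1 h2
    rw [h2, Pi.add_apply, condExp_const hm] at h1
    exact h1
  have he0 : ∀ᵐ ω ∂Q, -c ≤ condExp m Q (M 0) ω := by
    have := condExp_mono (m := m) (integrable_const (μ := Q) (-c)) (hMi 0) hMc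
    rw [condExp_const hm] at this
    exact this
  filter_upwards [condLExp_mono (mΩ := m) hle,
    condLExp_add_left (mΩ := m) (fun _ => ENNReal.ofReal c) ham.aemeasurable,
    condLExp_add_right (mΩ := m) (fun ω => ⨆ n, N n ω) hbm.aemeasurable,
    condLExp_iSup hm Q hNm hNmono, ae_all_iff.2 hMn, ae_all_iff.2 hA, hbt, he0]
    with ω h1 h2 h3 h4 h5 h6 h7 h8
  rw [h2, h3, Pi.add_apply, Pi.add_apply, ← h4, condLExp_const hm] at h1
  simp_rw [h5] at h1
  exact coe_sub_coe_le_of_add_le hc h7 h8 h6 h1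

end ConditionalExpectation

/-! ### Acceptable positions and induced risk. -/

section CPM

variable {Ω : Type*} {mT mt m0 : MeasurableSpace Ω} {P : Measure Ω}

theorem MemLbb.indicator {X : Ω → EReal} (hX : MemLbb mT P X) {B : Set Ω}
    (hB : MeasurableSet[mT] B) : MemLbb mT P (B.indicator X) := by
  obtain ⟨hm, c, hc⟩ := hX
  refine ⟨hm.indicator hB, min c 0, ?_⟩
  filter_upwards [hc] with ω hω
  by_cases h : ω ∈ B
  · rw [indicator_of_mem h]
    exact le_trans (EReal.coe_le_coe_iff.2 (min_le_left _ _)) hω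
  · rw [indicator_of_notMem h]
    exact EReal.coe_le_coe_iff.2 (min_le_right c 0)

theorem MemLbb.add {X Y : Ω → EReal} (hX : MemLbb mT P X) (hY : MemLbb mT P Y) :
    MemLbb mT P (fun ω => X ω + Y ω) := by
  obtain ⟨hm, c, hc⟩ := hX
  obtain ⟨hm', d, hd⟩ := hY
  refine ⟨hm.add hm', c + d, ?_⟩
  filter_upwards [hc, hd] with ω h1 h2
  rw [EReal.coe_add]
  exact add_le_add h1 h2

theorem MemLbb.mono {X : Ω → EReal} (hX : MemLbb mt P X) (h : mt ≤ mT) : MemLbb mT P X :=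
  ⟨hX.1.mono h le_rfl, hX.2⟩

theorem memLbb_const (c : ℝ) : MemLbb mT P (fun _ => (c : EReal)) :=
  ⟨measurable_const, c, Eventually.of_forall fun _ => le_rfl⟩

theorem MemLinf.memLbb {Z : Ω → ℝ} (hZ : MemLinf mT P Z) :
    MemLbb mT P (fun ω => (Z ω : EReal)) := by
  obtain ⟨hm, c, hc⟩ := hZ
  refine ⟨measurable_coe_real_ereal.comp hm, -c, ?_⟩
  filter_upwards [hc] with ω h
  exact EReal.coe_le_coe_iff.2 (abs_le.1 h).1

theorem memLinf_const (c : ℝ) : MemLinf mT P (fun _ => c) :=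
  ⟨measurable_const, |c|, Eventually.of_forall fun _ => le_rfl⟩

theorem MemLinf.mono {Z : Ω → ℝ} (hZ : MemLinf mt P Z) (h : mt ≤ mT) : MemLinf mT P Z :=
  ⟨hZ.1.mono h le_rfl, hZ.2⟩

theorem MemLinf.add {Z W : Ω → ℝ} (hZ : MemLinf mT P Z) (hW : MemLinf mT P W) :
    MemLinf mT P (fun ω => Z ω + W ω) := by
  obtain ⟨hm, c, hc⟩ := hZ
  obtain ⟨hm', d, hd⟩ := hW
  refine ⟨hm.add hm', c + d, ?_⟩
  filter_upwards [hc, hd] with ω h1 h2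
  exact (abs_add_le _ _).trans (add_le_add h1 h2)

theorem MemLinf.integrable {Z : Ω → ℝ} (hZ : MemLinf mT P Z) (hT : mT ≤ m0) {Q : Measure Ω}
    [IsFiniteMeasure Q] (hQP : Q ≪ P) : Integrable Z Q := by
  obtain ⟨hm, c, hc⟩ := hZ
  exact Integrable.of_bound (hm.mono hT le_rfl).aestronglyMeasurable c (hQP.ae_le hc)

/-- The variable equal to `Z` on `B` and to `W` off `B`. -/
noncomputable def paste (B : Set Ω) (Z W : Ω → ℝ) : Ω → ℝ := B.indicator Z + Bᶜ.indicator W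

theorem paste_of_mem {B : Set Ω} {ω : Ω} (h : ω ∈ B) (Z W : Ω → ℝ) : paste B Z W ω = Z ω := by
  simp [paste, h]

theorem paste_of_notMem {B : Set Ω} {ω : Ω} (h : ω ∉ B) (Z W : Ω → ℝ) :
    paste B Z W ω = W ω := by
  simp [paste, h]

theorem MemLinf.paste {Z W : Ω → ℝ} (hZ : MemLinf mT P Z) (hW : MemLinf mT P W) {B : Set Ω}
    (hB : MeasurableSet[mT] B) : MemLinf mT P (paste B Z W) := by
  obtain ⟨hm, c, hc⟩ := hZ
  obtain ⟨hm', d, hd⟩ := hW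
  refine ⟨(hm.indicator hB).add (hm'.indicator hB.compl), max c d, ?_⟩
  filter_upwards [hc, hd] with ω h1 h2
  by_cases h : ω ∈ B
  · rw [paste_of_mem h]; exact h1.trans (le_max_left _ _)
  · rw [paste_of_notMem h]; exact h2.trans (le_max_right _ _)

variable {zd zu : EReal} {β : (Ω → EReal) → (Ω → EReal)}

/-- A performance measure is monotone on every event of the conditioning σ-algebra. -/
theorem IsCPM.mono_on (hβ : IsCPM P mT mt zd zu β) (hmt : mt ≤ mT) {X Y : Ω → EReal}
    (hX : MemLbb mT P X) (hY : MemLbb mT P Y) {B : Set Ω} (hB : MeasurableSet[mt] B)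
    (h : ∀ᵐ ω ∂P, ω ∈ B → Y ω ≤ X ω) : ∀ᵐ ω ∂P, ω ∈ B → β Y ω ≤ β X ω := by
  -- Cutting both positions off outside `B` makes the comparison global; locality then removes the
  -- cut on `B`.
  have h1 := hβ.mono _ _ (hX.indicator (hmt B hB)) (hY.indicator (hmt B hB)) (by
    filter_upwards [h] with ω hω
    by_cases hωB : ω ∈ B
    · simpa [hωB] using hω hωB
    · simp [hωB])
  filter_upwards [h1, hβ.locality X hX B hB, hβ.locality Y hY B hB] with ω h1 h2 h3 hωB
  simp only [indicator_of_mem hωB] at h2 h3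
  rwa [h2, h3]

/-- The bounded positions whose performance is above the level `z`. -/
def strictAcceptance (P : Measure Ω) (mT : MeasurableSpace Ω) (β : (Ω → EReal) → (Ω → EReal))
    (z : ℝ) : Set (Ω → ℝ) :=
  {Y | MemLinf mT P Y ∧ ∀ᵐ ω ∂P, (z : EReal) < β (fun ω' => (Y ω' : EReal)) ω}

theorem IsCPM.paste_mem (hβ : IsCPM P mT mt zd zu β) (hmt : mt ≤ mT) {z : ℝ} {Y W : Ω → ℝ}
    (hY : Y ∈ strictAcceptance P mT β z) (hW : W ∈ strictAcceptance P mT β z) {B : Set Ω}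
    (hB : MeasurableSet[mt] B) : paste B Y W ∈ strictAcceptance P mT β z := by
  have hp := hY.1.paste hW.1 (hmt B hB)
  refine ⟨hp, ?_⟩
  have h1 := hβ.mono_on hmt hp.memLbb hY.1.memLbb hB
    (Eventually.of_forall fun ω h => by rw [paste_of_mem h])
  have h2 := hβ.mono_on hmt hp.memLbb hW.1.memLbb hB.compl
    (Eventually.of_forall fun ω h => by rw [paste_of_notMem h])
  filter_upwards [h1, h2, hY.2, hW.2] with ω h1 h2 h3 h4
  by_cases h : ω ∈ B
  · exact h3.trans_le (h1 h)
  · exact h4.trans_le (h2 h)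

theorem isEssInf_inducedRisk (hmt : mt ≤ m0) [IsFiniteMeasure P] (z : ℝ) (X : Ω → EReal) :
    IsEssInf mt P {ξ | MemLbb mt P ξ ∧ ∀ᵐ ω ∂P, (z : EReal) ≤ β (fun ω' => X ω' + ξ ω') ω}
      (inducedRisk P mt β z X) :=
  isEssInf_essInfFam hmt P fun _ hη => hη.1.1

theorem inducedRisk_nonpos (hmt : mt ≤ m0) [IsFiniteMeasure P] {z : ℝ} {Y : Ω → ℝ}
    (hY : Y ∈ strictAcceptance P mT β z) :
    ∀ᵐ ω ∂P, inducedRisk P mt β z (fun ω' => (Y ω' : EReal)) ω ≤ 0 := by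
  refine (isEssInf_inducedRisk (β := β) hmt z _).2.1 (fun _ => 0) ⟨memLbb_const 0, ?_⟩
  filter_upwards [hY.2] with ω h
  simpa using h.le

/-- If a constant reaches the level `z`, the induced risk of a bounded position is bounded. -/
theorem IsCPM.exists_inducedRisk_eq (hβ : IsCPM P mT mt zd zu β) (hmt : mt ≤ mT) (hmT : mT ≤ m0)
    [IsFiniteMeasure P] {z : ℝ} (hzd : zd < (z : EReal)) (hzu : (z : EReal) < zu) {x : ℝ}
    (hx : ∀ᵐ ω ∂P, (z : EReal) ≤ β (fun _ => (x : EReal)) ω) {Z : Ω → ℝ} (hZ : MemLinf mT P Z) :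
    ∃ r : Ω → ℝ, MemLinf mt P r ∧
      ∀ᵐ ω ∂P, inducedRisk P mt β z (fun ω' => (Z ω' : EReal)) ω = (r ω : EReal) := by
  obtain ⟨c, hc⟩ := hZ.2
  obtain ⟨y, hy⟩ := hβ.level_bdd z hzd hzu
  obtain ⟨hm, hle, hge⟩ :=
    isEssInf_inducedRisk (β := β) (P := P) (hmt.trans hmT) z (fun ω' => (Z ω' : EReal))
  have hup : ∀ᵐ ω ∂P, inducedRisk P mt β z (fun ω' => (Z ω' : EReal)) ω ≤ ((x + c : ℝ) : EReal) := by
    -- Since `Z ≥ -c`, the position `Z + (x + c)` dominates the acceptable constant `x`.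
    refine hle (fun _ => ((x + c : ℝ) : EReal)) ⟨memLbb_const _, ?_⟩
    have h1 := hβ.mono _ _ (hZ.memLbb.add (memLbb_const (x + c))) (memLbb_const x) (by
      filter_upwards [hc] with ω hω
      rw [← EReal.coe_add, EReal.coe_le_coe_iff]
      linarith [(abs_le.1 hω).1])
    filter_upwards [h1, hx] with ω h1 h2
    exact h2.trans h1
  have hlo : ∀ᵐ ω ∂P, ((y - c : ℝ) : EReal) ≤ inducedRisk P mt β z (fun ω' => (Z ω' : EReal)) ω := by
    refine hge (fun _ => ((y - c : ℝ) : EReal)) measurable_const ?_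
    rintro ξ ⟨hξ, hξz⟩
    -- `c + ξ` dominates `Z + ξ`, hence is acceptable; being known at the conditioning date, it is
    -- at least `y`.
    have hξ' : MemLbb mt P (fun ω => (c : EReal) + ξ ω) := (memLbb_const c).add hξ
    have h1 := hβ.mono _ _ (hξ'.mono hmt) (hZ.memLbb.add (hξ.mono hmt)) (by
      filter_upwards [hc] with ω hω
      exact add_le_add_left (EReal.coe_le_coe_iff.2 (abs_le.1 hω).2) _)
    have h2 := hy _ hξ' (by
      filter_upwards [h1, hξz] with ω h1 h2
      exact h2.trans h1)
    filter_upwards [h2] with ω h2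
    rw [EReal.coe_sub]
    exact EReal.sub_le_of_le_add (by rwa [add_comm] at h2)
  refine ⟨fun ω => (inducedRisk P mt β z (fun ω' => (Z ω' : EReal)) ω).toReal,
    ⟨measurable_ereal_toReal.comp hm, max |x + c| |y - c|, ?_⟩, ?_⟩
  · filter_upwards [hup, hlo] with ω h1 h2
    generalize inducedRisk P mt β z (fun ω' => (Z ω' : EReal)) ω = ρ at h1 h2
    induction ρ with
    | bot => exact absurd h2 (not_le.2 (EReal.bot_lt_coe _))
    | top => exact absurd h1 (not_le.2 (EReal.coe_lt_top _))
    | coe ρ =>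
      rw [EReal.coe_le_coe_iff] at h1 h2
      rw [EReal.toReal_coe, max_comm]
      exact abs_le_max_abs_abs h2 h1
  · filter_upwards [hup, hlo] with ω h1 h2
    exact (EReal.coe_toReal (ne_top_of_le_ne_top (EReal.coe_ne_top _) h1)
      (ne_bot_of_le_ne_bot (EReal.coe_ne_bot _) h2)).symm

/-- Adding slightly more than its induced risk to a bounded position makes it acceptable. -/
theorem IsCPM.le_apply_add_risk (hβ : IsCPM P mT mt zd zu β) (hmt : mt ≤ mT) (hmT : mT ≤ m0)
    [IsFiniteMeasure P] {z : ℝ} {Z r : Ω → ℝ} (hZ : MemLinf mT P Z) (hr : MemLinf mt P r)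
    (hrisk : ∀ᵐ ω ∂P, inducedRisk P mt β z (fun ω' => (Z ω' : EReal)) ω = (r ω : EReal))
    {ε : ℝ} (hε : 0 < ε) :
    ∀ᵐ ω ∂P, (z : EReal) ≤ β (fun ω' => ((Z ω' + r ω' + ε : ℝ) : EReal)) ω := by
  obtain ⟨-, hle, hge⟩ :=
    isEssInf_inducedRisk (β := β) (P := P) (hmt.trans hmT) z (fun ω' => (Z ω' : EReal))
  set Y : Ω → EReal := fun ω' => ((Z ω' + r ω' + ε : ℝ) : EReal) with hYdef
  have hY : MemLbb mT P Y := ((hZ.add (hr.mono hmt)).add (memLinf_const ε)).memLbb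
  set B : Set Ω := {ω | β Y ω < (z : EReal)} with hBdef
  have hB : MeasurableSet[mt] B := (hβ.mem Y hY).1 measurableSet_Iio
  -- Where an admissible `ξ` is at most `r + ε`, local monotonicity makes `Y` acceptable too, so
  -- this cannot happen on the failure event `B`.
  have key : ∀ ξ, MemLbb mt P ξ →
      (∀ᵐ ω ∂P, (z : EReal) ≤ β (fun ω' => (Z ω' : EReal) + ξ ω') ω) →
      ∀ᵐ ω ∂P, ω ∈ B → ((r ω + ε : ℝ) : EReal) ≤ ξ ω := by
    intro ξ hξ hξz
    have hD : MeasurableSet[mt] {ω | ξ ω ≤ ((r ω + ε : ℝ) : EReal)} :=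
      @measurableSet_le _ _ _ _ _ mt _ _ _ _ _ hξ.1
        (measurable_coe_real_ereal.comp (hr.1.add_const ε))
    have h1 := hβ.mono_on hmt hY (hZ.memLbb.add (hξ.mono hmt)) hD
      (Eventually.of_forall fun ω (hω : ξ ω ≤ ((r ω + ε : ℝ) : EReal)) => by
        rw [hYdef]
        simp only [add_assoc]
        rw [EReal.coe_add (Z ω)]
        exact add_le_add_right hω _)
    filter_upwards [h1, hξz] with ω h1 h2 hωB
    by_contra h3
    exact absurd hωB (not_lt.2 (h2.trans (h1 (not_le.1 h3).le)))
  -- Thus `r + ε 1_B` is still a lower bound of the admissible `ξ`; as `r` is the greatest one, `B`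
  -- is null.
  have h1 := hge (fun ω => ((r ω + B.indicator (fun _ => ε) ω : ℝ) : EReal))
    (measurable_coe_real_ereal.comp (hr.1.add (measurable_const.indicator hB))) (by
      rintro ξ ⟨hξ, hξz⟩
      filter_upwards [key ξ hξ hξz, hle ξ ⟨hξ, hξz⟩, hrisk] with ω h1 h2 h3
      by_cases hω : ω ∈ B
      · simpa [hω] using h1 hω
      · simpa [hω, h3] using h2)
  filter_upwards [h1, hrisk] with ω h1 h2
  by_contra h3
  have hω : ω ∈ B := not_le.1 h3
  rw [h2, EReal.coe_le_coe_iff, indicator_of_mem hω] at h1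
  linarith

/-- One half of `ε` brings the performance to at least `z`; the other half makes the inequality
strict. -/
theorem IsCPM.add_risk_mem (hβ : IsCPM P mT mt zd zu β) (hmt : mt ≤ mT) (hmT : mT ≤ m0)
    [IsFiniteMeasure P] {z : ℝ} (hzd : zd < (z : EReal)) (hzu : (z : EReal) < zu)
    {Z r : Ω → ℝ} (hZ : MemLinf mT P Z) (hr : MemLinf mt P r)
    (hrisk : ∀ᵐ ω ∂P, inducedRisk P mt β z (fun ω' => (Z ω' : EReal)) ω = (r ω : EReal))
    {ε : ℝ} (hε : 0 < ε) :
    (fun ω => Z ω + r ω + ε) ∈ strictAcceptance P mT β z := by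
  have hZr := hZ.add (hr.mono hmt)
  refine ⟨hZr.add (memLinf_const ε), ?_⟩
  have h0 := hβ.le_apply_add_risk hmt hmT hZ hr hrisk (half_pos hε)
  have hX := (hZr.add (memLinf_const (ε / 2))).memLbb
  have hs := hβ.strict_mono_shift _ hX (ε / 2) (half_pos hε)
  have hm := hβ.mono _ _ (hX.add (memLbb_const (ε / 2))) hX (Eventually.of_forall fun ω => by
    rw [← EReal.coe_add, EReal.coe_le_coe_iff]; linarith)
  have heq : (fun ω => ((Z ω + r ω + ε / 2 : ℝ) : EReal) + ((ε / 2 : ℝ) : EReal))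
      = fun ω => ((Z ω + r ω + ε : ℝ) : EReal) := by
    funext ω
    rw [← EReal.coe_add]
    congr 1; ring
  rw [heq] at hs hm
  filter_upwards [h0, hs, hm] with ω h0 hs hm
  -- A shift is strictly increasing only below `zu`; elsewhere `z < zu` already gives strictness.
  by_cases h : β (fun ω' => ((Z ω' + r ω' + ε / 2 : ℝ) : EReal)) ω < zu
  · exact h0.trans_lt (hs h (hzd.trans_le (h0.trans hm)))
  · exact hzu.trans_le ((not_lt.1 h).trans hm)

end CPM

/-! ### The minimal penalty as a directed supremum over acceptable positions. -/

section Penalty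

variable {Ω : Type*} {mT mt m0 : MeasurableSpace Ω} {P Q : Measure Ω}

theorem measurable_coe_condExp (Z : Ω → ℝ) :
    Measurable[mt] (fun ω => ((condExp mt Q Z ω : ℝ) : EReal)) :=
  measurable_coe_real_ereal.comp stronglyMeasurable_condExp.measurable

theorem condExp_paste (hmt : mt ≤ m0) [IsFiniteMeasure Q] {Y W : Ω → ℝ} (hY : Integrable Y Q)
    (hW : Integrable W Q) {B : Set Ω} (hB : MeasurableSet[mt] B) :
    condExp mt Q (paste B Y W) =ᵐ[Q] paste B (condExp mt Q Y) (condExp mt Q W) :=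
  (condExp_add (hY.indicator (hmt B hB)) (hW.indicator (hmt B hB).compl) mt).trans
    ((condExp_indicator hY hB).add (condExp_indicator hW hB.compl))

theorem MemLinf.exists_le_condExp_neg (hmt : mt ≤ m0) (hmT : mT ≤ m0) [IsFiniteMeasure Q]
    (hQP : Q ≪ P) {Y : Ω → ℝ} (hY : MemLinf mT P Y) :
    ∃ c : ℝ, 0 ≤ c ∧ ∀ᵐ ω ∂Q, -c ≤ condExp mt Q (fun ω' => - Y ω') ω := by
  obtain ⟨c, hc⟩ := hY.2
  refine ⟨|c|, abs_nonneg c, ?_⟩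
  have h : (fun _ => -|c|) ≤ᵐ[Q] fun ω' => - Y ω' := by
    filter_upwards [hQP.ae_le hc] with ω hω
    linarith [le_abs_self c, (abs_le.1 hω).2]
  have := condExp_mono (m := mt) (integrable_const (-|c|)) (hY.integrable hmT hQP).neg h
  rw [condExp_const hmt] at this
  exact this

variable {zd zu : EReal} {β : (Ω → EReal) → (Ω → EReal)}

theorem isEssSup_minPenalty (hmt : mt ≤ m0) [IsFiniteMeasure P] [IsFiniteMeasure Q] (z : ℝ) :
    IsEssSup mt Q {η | ∃ Z : Ω → ℝ, MemLinf mT P Z ∧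
      η = fun ω => ((condExp mt Q (fun ω' => - Z ω') ω : ℝ) : EReal)
        - inducedRisk P mt β z (fun ω' => (Z ω' : EReal)) ω}
      (minPenalty P Q mT mt β z) := by
  refine isEssSup_essSupFam hmt Q ?_
  rintro _ ⟨Z, -, rfl⟩
  simp only [sub_eq_add_neg]
  exact (measurable_coe_condExp _).add
    (measurable_neg.comp (isEssInf_inducedRisk (β := β) (P := P) hmt z _).1)

/-- An acceptable position has nonpositive risk, so dropping the risk only lowers its term in the
supremum. No constant in the level set is needed, so this applies directly at date `s`. -/
theorem condExp_neg_le_minPenalty (hmt : mt ≤ m0) [IsFiniteMeasure P] [IsFiniteMeasure Q]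
    (hQP : Q ≪ P) {z : ℝ} {Y : Ω → ℝ} (hY : Y ∈ strictAcceptance P mT β z) :
    ∀ᵐ ω ∂Q, ((condExp mt Q (fun ω' => - Y ω') ω : ℝ) : EReal) ≤ minPenalty P Q mT mt β z ω := by
  have h := (isEssSup_minPenalty (mT := mT) (P := P) (Q := Q) (β := β) hmt z).2.1 _ ⟨Y, hY.1, rfl⟩
  filter_upwards [h, hQP.ae_le (inducedRisk_nonpos hmt hY)] with ω h1 h2
  refine le_trans ?_ h1
  simpa using EReal.sub_le_sub le_rfl h2

/-- The acceptable position `Z + r + ε`, with `r` the risk of `Z`, has conditional loss `E^Q[-Z |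
mt] - r - ε`; let `ε` decrease to `0` along `1 / (n + 1)`. -/
theorem IsCPM.minPenalty_le (hβ : IsCPM P mT mt zd zu β) (hmt : mt ≤ mT) (hmT : mT ≤ m0)
    [IsFiniteMeasure P] [IsFiniteMeasure Q] (hQP : Q ≪ P) {z : ℝ} (hzd : zd < (z : EReal))
    (hzu : (z : EReal) < zu) {x : ℝ} (hx : ∀ᵐ ω ∂P, (z : EReal) ≤ β (fun _ => (x : EReal)) ω)
    {ζ : Ω → EReal} (hζ : Measurable[mt] ζ)
    (h : ∀ Y ∈ strictAcceptance P mT β z,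
      ∀ᵐ ω ∂Q, ((condExp mt Q (fun ω' => - Y ω') ω : ℝ) : EReal) ≤ ζ ω) :
    ∀ᵐ ω ∂Q, minPenalty P Q mT mt β z ω ≤ ζ ω := by
  have hm0 := hmt.trans hmT
  refine (isEssSup_minPenalty hm0 z).2.2 ζ hζ ?_
  rintro _ ⟨Z, hZ, rfl⟩
  obtain ⟨r, hr, hrisk⟩ := hβ.exists_inducedRisk_eq hmt hmT hzd hzu hx hZ
  have hε : ∀ n : ℕ, ∀ᵐ ω ∂Q,
      ((condExp mt Q (fun ω' => - Z ω') ω - r ω - 1 / ((n : ℝ) + 1) : ℝ) : EReal) ≤ ζ ω := by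
    intro n
    have hY := h _ (hβ.add_risk_mem hmt hmT hzd hzu hZ hr hrisk (Nat.one_div_pos_of_nat (n := n)))
    have hc : MemLinf mt P (fun ω => r ω + 1 / ((n : ℝ) + 1)) := hr.add (memLinf_const _)
    have hs := condExp_sub (hZ.integrable hmT hQP).neg (hc.integrable hm0 hQP) mt
    rw [condExp_of_stronglyMeasurable hm0 hc.1.stronglyMeasurable (hc.integrable hm0 hQP)] at hs
    have heq : (fun ω => -(Z ω + r ω + 1 / ((n : ℝ) + 1)))
        = -Z - fun ω => r ω + 1 / ((n : ℝ) + 1) := by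
      funext ω; simp only [Pi.sub_apply, Pi.neg_apply]; ring
    rw [heq] at hY
    filter_upwards [hY, hs] with ω h1 h2
    rw [h2] at h1
    refine le_trans (EReal.coe_le_coe_iff.2 (le_of_eq ?_)) h1
    change condExp mt Q (-Z) ω - _ - _ = _
    simp only [Pi.sub_apply]; ring
  filter_upwards [ae_all_iff.2 hε, hQP.ae_le hrisk] with ω h1 h2
  rw [h2, ← EReal.coe_sub]
  have hlim : Tendsto (fun n : ℕ => condExp mt Q (fun ω' => - Z ω') ω - r ω - 1 / ((n : ℝ) + 1))
      atTop (𝓝 (condExp mt Q (fun ω' => - Z ω') ω - r ω)) := by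
    simpa using tendsto_const_nhds.sub (tendsto_one_div_add_atTop_nhds_zero_nat (𝕜 := ℝ))
  exact le_of_tendsto' ((continuous_coe_real_ereal.tendsto _).comp hlim) h1

/-- Take `Y` where its conditional loss is the larger one and `W` elsewhere: the event is
`mt`-measurable, so pasting preserves acceptability and commutes with conditioning. -/
theorem IsCPM.exists_condExp_neg_sup_le (hβ : IsCPM P mT mt zd zu β) (hmt : mt ≤ mT)
    (hmT : mT ≤ m0) [IsFiniteMeasure Q] (hQP : Q ≪ P) {z : ℝ} {Y W : Ω → ℝ}
    (hY : Y ∈ strictAcceptance P mT β z) (hW : W ∈ strictAcceptance P mT β z) :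
    ∃ V ∈ strictAcceptance P mT β z,
      condExp mt Q (fun ω' => - Y ω') ⊔ condExp mt Q (fun ω' => - W ω')
        ≤ᵐ[Q] condExp mt Q (fun ω' => - V ω') := by
  set y := condExp mt Q (fun ω' => - Y ω') with hy
  set w := condExp mt Q (fun ω' => - W ω') with hw
  have hB : MeasurableSet[mt] {ω | w ω ≤ y ω} :=
    @measurableSet_le _ _ _ _ _ mt _ _ _ _ _ stronglyMeasurable_condExp.measurable
      stronglyMeasurable_condExp.measurable
  refine ⟨_, hβ.paste_mem hmt hY hW hB, ?_⟩
  have heq : (fun ω => - paste {ω | w ω ≤ y ω} Y W ω)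
      = paste {ω | w ω ≤ y ω} (fun ω => - Y ω) (fun ω => - W ω) := by
    funext ω
    by_cases h : ω ∈ {ω | w ω ≤ y ω}
    · rw [paste_of_mem h, paste_of_mem h]
    · rw [paste_of_notMem h, paste_of_notMem h]
  rw [heq]
  filter_upwards [condExp_paste (hmt.trans hmT) (hY.1.integrable hmT hQP).neg
    (hW.1.integrable hmT hQP).neg hB] with ω hω
  refine le_trans ?_ (ge_of_eq hω)
  change y ω ⊔ w ω ≤ paste _ y w ω
  by_cases h : ω ∈ {ω | w ω ≤ y ω}
  · rw [paste_of_mem h]; exact sup_le le_rfl h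
  · rw [paste_of_notMem h]; exact sup_le (not_le.1 h).le le_rfl

/-- The minimal penalty is dominated by the supremum of a sequence of conditional expectations of
losses of acceptable positions. -/
theorem IsCPM.exists_seq_minPenalty_le (hβ : IsCPM P mT mt zd zu β) (hmt : mt ≤ mT)
    (hmT : mT ≤ m0) [IsFiniteMeasure P] [IsFiniteMeasure Q] (hQP : Q ≪ P) {z : ℝ}
    (hzd : zd < (z : EReal)) (hzu : (z : EReal) < zu) {x : ℝ}
    (hx : ∀ᵐ ω ∂P, (z : EReal) ≤ β (fun _ => (x : EReal)) ω) :
    ∃ Y : ℕ → Ω → ℝ, (∀ n, Y n ∈ strictAcceptance P mT β z) ∧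
      ∀ᵐ ω ∂Q, minPenalty P Q mT mt β z ω
        ≤ ⨆ n, ((condExp mt Q (fun ω' => - Y n ω') ω : ℝ) : EReal) := by
  have hm0 := hmt.trans hmT
  set S : Set (Ω → EReal) := (fun Y ω => ((condExp mt Q (fun ω' => - Y ω') ω : ℝ) : EReal)) ''
    strictAcceptance P mT β z with hS
  have hSm : ∀ η ∈ S, Measurable[mt] η := by
    rintro _ ⟨Y, -, rfl⟩
    exact measurable_coe_condExp _
  obtain ⟨r, hr, hrisk⟩ := hβ.exists_inducedRisk_eq hmt hmT hzd hzu hx (memLinf_const 0)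
  have hne : S.Nonempty :=
    ⟨_, _, hβ.add_risk_mem hmt hmT hzd hzu (memLinf_const 0) hr hrisk one_pos, rfl⟩
  obtain ⟨η₀, hη₀⟩ := hne
  obtain ⟨C, hCS, hC, hdom⟩ :=
    exists_countable_dominating Q S fun η hη => (hSm η hη).mono hm0 le_rfl
  -- Inserting `η₀` guards against an empty `C`, which no sequence could enumerate.
  obtain ⟨f, hf⟩ := (hC.insert η₀).exists_eq_range (insert_nonempty η₀ C)
  have hfS : ∀ n, f n ∈ S := fun n =>
    insert_subset hη₀ hCS (by rw [hf]; exact mem_range_self n)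
  choose Y hYmem hYf using hfS
  refine ⟨Y, hYmem, hβ.minPenalty_le hmt hmT hQP hzd hzu hx
    (Measurable.iSup fun n => measurable_coe_condExp _) fun W hW => ?_⟩
  filter_upwards [hdom _ (mem_image_of_mem _ hW)] with ω hω
  refine hω.trans (iSup₂_le fun θ hθ => ?_)
  obtain ⟨n, rfl⟩ : θ ∈ range f := hf ▸ mem_insert_of_mem _ hθ
  rw [← hYf n]
  exact le_iSup (fun n => ((condExp mt Q (fun ω' => - Y n ω') ω : ℝ) : EReal)) n

theorem IsCPM.exists_partialSups_le (hβ : IsCPM P mT mt zd zu β) (hmt : mt ≤ mT)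
    (hmT : mT ≤ m0) [IsFiniteMeasure Q] (hQP : Q ≪ P) {z : ℝ} {Y : ℕ → Ω → ℝ}
    (hY : ∀ n, Y n ∈ strictAcceptance P mT β z) (n : ℕ) :
    ∃ W ∈ strictAcceptance P mT β z,
      partialSups (fun k => condExp mt Q (fun ω' => - Y k ω')) n
        ≤ᵐ[Q] condExp mt Q (fun ω' => - W ω') := by
  induction n with
  | zero => exact ⟨Y 0, hY 0, by rw [partialSups_zero]⟩
  | succ n ih =>
    obtain ⟨W, hW, hle⟩ := ih
    obtain ⟨V, hV, hle'⟩ := hβ.exists_condExp_neg_sup_le hmt hmT hQP hW (hY (n + 1))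
    refine ⟨V, hV, ?_⟩
    rw [partialSups_add_one]
    filter_upwards [hle, hle'] with ω h1 h2
    exact (sup_le_sup_right h1 _).trans h2

theorem measurable_partialSups {y : ℕ → Ω → ℝ} (hy : ∀ n, Measurable (y n)) (n : ℕ) :
    Measurable (partialSups y n) := by
  induction n with
  | zero => rw [partialSups_zero]; exact hy 0
  | succ n ih => rw [partialSups_add_one]; exact ih.sup (hy (n + 1))

theorem integrable_partialSups {y : ℕ → Ω → ℝ} (hy : ∀ n, Integrable (y n) Q) (n : ℕ) :
    Integrable (partialSups y n) Q := by
  induction n with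
  | zero => rw [partialSups_zero]; exact hy 0
  | succ n ih => rw [partialSups_add_one]; exact ih.sup (hy (n + 1))

end Penalty

end PerfMeas

/-! ### The supermartingale inequality. -/

theorem mainTheorem7 {Ω : Type*} {mΩ : MeasurableSpace Ω} (P : Measure Ω) [IsProbabilityMeasure P]
    (T : ℝ) (_hTpos : 0 < T) (𝒯 : Set ℝ) (_h𝒯 : 𝒯 ⊆ Set.Icc 0 T) (hT : T ∈ 𝒯)
    (𝓕 : Filtration 𝒯 mΩ) (zd zu : EReal) (β : 𝒯 → (Ω → EReal) → (Ω → EReal))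
    (hβ : PerfMeas.IsDPM P 𝓕 ⟨T, hT⟩ zd zu β)
    (htc : PerfMeas.IsTimeConsistent P 𝓕 ⟨T, hT⟩ zd zu β)
    (z : ℝ) (hzd : zd < (z : EReal)) (hzu : (z : EReal) < zu)
    (s t : 𝒯) (hst : s < t)
    (hconst : ∃ x : ℝ, ∀ᵐ ω ∂P, (z : EReal) ≤ β t (fun _ => (x : EReal)) ω)
    (Q : Measure Ω) [IsProbabilityMeasure Q] (hQP : Q ≪ P) :
    PerfMeas.MemLbb (𝓕 t) Q (PerfMeas.minPenalty P Q (𝓕 ⟨T, hT⟩) (𝓕 t) (β t) z) ∧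
      ∀ᵐ ω ∂Q, PerfMeas.condExpExt (𝓕 s) Q
          (PerfMeas.minPenalty P Q (𝓕 ⟨T, hT⟩) (𝓕 t) (β t) z) ω
        ≤ PerfMeas.minPenalty P Q (𝓕 ⟨T, hT⟩) (𝓕 s) (β s) z ω := by
  have htT : t ≤ ⟨T, hT⟩ := Subtype.coe_le_coe.1 (_h𝒯 t.2).2
  have hmt : 𝓕 t ≤ 𝓕 ⟨T, hT⟩ := 𝓕.mono htT
  have hmT : 𝓕 ⟨T, hT⟩ ≤ mΩ := 𝓕.le _
  have hm0 : 𝓕 t ≤ mΩ := 𝓕.le t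
  have hms : 𝓕 s ≤ mΩ := 𝓕.le s
  have hcpm := hβ t
  obtain ⟨x, hx⟩ := hconst
  obtain ⟨Y, hY, hle⟩ := hcpm.exists_seq_minPenalty_le hmt hmT hQP hzd hzu hx
  obtain ⟨c, hc0, hc⟩ := (hY 0).1.exists_le_condExp_neg hm0 hmT hQP
  have hlow : ∀ᵐ ω ∂Q, ((-c : ℝ) : EReal) ≤ PerfMeas.minPenalty P Q (𝓕 ⟨T, hT⟩) (𝓕 t) (β t) z ω := by
    filter_upwards [hc, PerfMeas.condExp_neg_le_minPenalty hm0 hQP (hY 0)] with ω h1 h2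
    exact (EReal.coe_le_coe_iff.2 h1).trans h2
  have hmeas := (PerfMeas.isEssSup_minPenalty (mT := 𝓕 ⟨T, hT⟩) (P := P) (Q := Q) (β := β t) hm0 z).1
  refine ⟨⟨hmeas, -c, hlow⟩, ?_⟩
  set y : ℕ → Ω → ℝ := fun k => condExp (𝓕 t) Q (fun ω' => - Y k ω') with hy
  have hyi : ∀ n, Integrable (y n) Q := fun n => integrable_condExp
  have hym : ∀ n, Measurable (y n) := fun n =>
    (stronglyMeasurable_condExp.mono hm0).measurable
  -- The running maxima increase in `n` by construction, whereas the acceptable positions whose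
  -- losses dominate them need not have monotone conditional losses.
  refine PerfMeas.condExpExt_le_of_le_iSup hms Q (hmeas.mono hm0 le_rfl)
    (PerfMeas.measurable_partialSups hym) (PerfMeas.integrable_partialSups hyi)
    (partialSups y).monotone hc0 hlow (by rwa [partialSups_zero]) ?_ fun n => ?_
  · filter_upwards [hle] with ω hω
    exact hω.trans (iSup_mono fun n => EReal.coe_le_coe_iff.2 (le_partialSups y n ω))
  · obtain ⟨W, hW, hWle⟩ := hcpm.exists_partialSups_le hmt hmT hQP hY n
    -- Time consistency enters here: one bounded position dominates the whole running maximum and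
    -- stays acceptable at `s`.
    have hWs : W ∈ PerfMeas.strictAcceptance P (𝓕 ⟨T, hT⟩) (β s) z :=
      ⟨hW.1, htc z hzd hzu _ hW.1.memLbb s t hst hW.2⟩
    filter_upwards [condExp_mono (m := 𝓕 s) (PerfMeas.integrable_partialSups hyi n)
      integrable_condExp hWle, condExp_condExp_of_le (μ := Q) (f := fun ω' => - W ω')
      (𝓕.mono hst.le) hm0, PerfMeas.condExp_neg_le_minPenalty hms hQP hWs] with ω h1 h2 h3
    exact (EReal.coe_le_coe_iff.2 (h1.trans h2.le)).trans h3
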